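/- **Definitions.** Let $A$ be an alphabet and $Q$ a finite set of states. For an infinite word $r$ let $\inf(r)$ be the set of letters occurring infinitely often in $r$. Let $M(Q)$ be the set of expressions built from states $q\in Q$, the connectives $\vee,\wedge$ and the constants $0$ (false), $1$ (true); a set $S\subseteq Q$ satisfies an expression if the expression is true when exactly the states in $S$ are set to true. A *(transition-controlled) alternating automaton* over $A$ with state set $Q$ is given by an initial condition in $M(Q)$, a transition function $\delta\colon Q\times A\to M(Q)$, and a recurrence condition. A *run* on $u\in A^\omega$ is a prefix-closed set $T\subseteq Q^*$ such that for every $vq\in T$ (with $v \in Q^*$, $q\in Q$) the set $\{q'\mid vqq'\in T\}$ satisfies $\delta(q,u(|v|))$. It is *initial* if $\{q\in Q\mid q\in T\}$ satisfies the initial condition, and *recurring* if every $r\in Q^\omega$ all of whose finite prefixes belong to $T$ satisfies the recurrence condition. The automaton recognizes the set of words on which it has an initial recurring run; two automata are *equivalent* if they recognize the same set of $\omega$-words. A *state-controlled* alternating automaton is instead given by a partition of $Q$ into existential and universal states, a relation $\Delta\subseteq Q\times A\times Q$, a set $Q_I$ of initial states that consists of existential states only or of universal states only, and a recurrence condition.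 A run on $u$ is a prefix-closed $T\subseteq Q^*$ such that for every $vq\in T$: if $q$ is existential, then $vqq'\in T$ for some $q'$ with $\langle q,u(|v|),q'\rangle\in\Delta$; if $q$ is universal, then $vqq'\in T$ for all such $q'$. It is initial if either all states in $Q_I$ are existential and $Q_I\cap T\ne\emptyset$, or all states in $Q_I$ are universal and $Q_I\subseteq T$. Recurring runs, the recognized language, and equivalence are as before. The automaton is a *Büchi* automaton if the recurrence condition is $\inf(r)\cap B\neq\emptyset$ for a given $B\subseteq Q$. A transition-controlled automaton is *weak* if the recurrence condition is $\inf(r)\subseteq W$ for a given $W\subseteq Q$ that is a union of strongly connected components of the directed graph on $Q$ with an edge from $q$ to $q'$ whenever $q'$ occurs in $\delta(q,a)$ for some $a\in A$. **Theorem (from alternating to weak alternating).** For every alternating Büchi automaton (transition-controlled or state-controlled) with state set $Q$, $|Q|=n$, there exists an equivalent transition-controlled weak alternating automaton with $2n^2$ states, namely with state set $Q\times\{0,\dots,2n-1\}$. -/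

import Mathlib

namespace OmegaAutomata

/-- Expressions built from the elements of `Q`, the connectives "or" and "and", and the boolean
constants "false" and "true". -/
inductive Expr (Q : Type*) where
  | state (q : Q) : Expr Q
  | or (φ ψ : Expr Q) : Expr Q
  | and (φ ψ : Expr Q) : Expr Q
  | false : Expr Q
  | true : Expr Q

namespace Expr

variable {Q : Type*}

/-- A set `S` of states satisfies an expression: a state counts as true iff it belongs to `S`. -/
def SatisfiedBy (S : Set Q) : Expr Q → Prop
  | state q => q ∈ S
  | or φ ψ => SatisfiedBy S φ ∨ SatisfiedBy S ψ
  | and φ ψ => SatisfiedBy S φ ∧ SatisfiedBy S ψ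
  | false => False
  | true => True

/-- The set of states occurring in an expression. -/
def states : Expr Q → Set Q
  | state q => {q}
  | or φ ψ => states φ ∪ states ψ
  | and φ ψ => states φ ∪ states ψ
  | false => ∅
  | true => ∅

end Expr

/-- The set of letters that occur infinitely often in an infinite word. -/
def infOcc {Q : Type*} (r : ℕ → Q) : Set Q := {q | {i | r i = q}.Infinite}

/-- A set of finite words closed under taking prefixes. -/
def PrefixClosed {Q : Type*} (T : Set (List Q)) : Prop :=
  ∀ v w : List Q, v <+: w → w ∈ T → v ∈ T

/-- `r` is an infinite rooted path through `T`: all finite prefixes `r 0 ⋯ r (k - 1)` of `r`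
belong to `T`. -/
def IsPath {Q : Type*} (T : Set (List Q)) (r : ℕ → Q) : Prop :=
  ∀ k : ℕ, (List.range k).map r ∈ T

/-- A transition-controlled alternating automaton without its recurrence condition. -/
structure Alternating (A Q : Type*) where
  /-- the initial condition -/
  init : Expr Q
  /-- the transition function -/
  δ : Q → A → Expr Q

namespace Alternating

variable {A Q : Type*} (𝒜 : Alternating A Q)

/-- `T` is a run on the infinite word `u`. -/
def IsRun (u : ℕ → A) (T : Set (List Q)) : Prop :=
  PrefixClosed T ∧
    ∀ (v : List Q) (q : Q), v ++ [q] ∈ T →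
      (𝒜.δ q (u v.length)).SatisfiedBy {q' | v ++ [q, q'] ∈ T}

/-- The run `T` is initial. -/
def IsInitial (T : Set (List Q)) : Prop :=
  𝒜.init.SatisfiedBy {q | [q] ∈ T}

/-- There is an edge from `q` to `q'` if `q'` occurs in the expression `δ(q, a)` for some letter
`a`. -/
def Edge (q q' : Q) : Prop := ∃ a : A, q' ∈ (𝒜.δ q a).states

/-- The strongly connected component of the state `q` in the transition graph. -/
def scc (q : Q) : Set Q :=
  {q' | Relation.ReflTransGen 𝒜.Edge q q' ∧ Relation.ReflTransGen 𝒜.Edge q' q}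

end Alternating

/-- A transition-controlled alternating Büchi automaton. -/
structure AlternatingBuchi (A Q : Type*) extends Alternating A Q where
  /-- the set of Büchi states -/
  buchi : Set Q

/-- The language recognized by an alternating Büchi automaton: the infinite words on which there is
an initial run all of whose infinite rooted paths visit Büchi states infinitely often. -/
def AlternatingBuchi.language {A Q : Type*} (𝒜 : AlternatingBuchi A Q) : Set (ℕ → A) :=
  {u | ∃ T : Set (List Q), 𝒜.IsRun u T ∧ 𝒜.IsInitial T ∧
    ∀ r : ℕ → Q, IsPath T r → (infOcc r ∩ 𝒜.buchi).Nonempty}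

/-- A transition-controlled weak alternating automaton: the set of weak states is a union of
strongly connected components of the transition graph. -/
structure AlternatingWeak (A Q : Type*) extends Alternating A Q where
  /-- the set of weak states -/
  weak : Set Q
  weak_eq_sUnion : ∃ 𝒞 : Set (Set Q), 𝒞 ⊆ Set.range toAlternating.scc ∧ weak = ⋃₀ 𝒞

/-- The language recognized by a weak alternating automaton: the infinite words on which there is
an initial run such that on all of its infinite rooted paths only weak states occur infinitely
often. -/
def AlternatingWeak.language {A Q : Type*} (𝒜 : AlternatingWeak A Q) : Set (ℕ → A) :=
  {u | ∃ T : Set (List Q), 𝒜.IsRun u T ∧ 𝒜.IsInitial T ∧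
    ∀ r : ℕ → Q, IsPath T r → infOcc r ⊆ 𝒜.weak}

/-- A state-controlled alternating Büchi automaton. The set of universal states is the complement
of the set of existential states. -/
structure StateAlternatingBuchi (A Q : Type*) where
  /-- the set of existential states -/
  existential : Set Q
  /-- the set of initial states -/
  init : Set Q
  init_subset : init ⊆ existential ∨ init ⊆ existentialᶜ
  /-- the transition relation -/
  Δ : Set (Q × A × Q)
  /-- the set of Büchi states -/
  buchi : Set Q

namespace StateAlternatingBuchi

variable {A Q : Type*} (𝒜 : StateAlternatingBuchi A Q)

/-- `T` is a run on the infinite word `u`. -/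
def IsRun (u : ℕ → A) (T : Set (List Q)) : Prop :=
  PrefixClosed T ∧
    ∀ (v : List Q) (q : Q), v ++ [q] ∈ T →
      (q ∈ 𝒜.existential → ∃ q', v ++ [q, q'] ∈ T ∧ (q, u v.length, q') ∈ 𝒜.Δ) ∧
      (q ∉ 𝒜.existential → ∀ q', (q, u v.length, q') ∈ 𝒜.Δ → v ++ [q, q'] ∈ T)

/-- The run `T` is initial. -/
def IsInitial (T : Set (List Q)) : Prop :=
  (𝒜.init ⊆ 𝒜.existential ∧ ∃ q ∈ 𝒜.init, [q] ∈ T) ∨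
    (𝒜.init ⊆ 𝒜.existentialᶜ ∧ ∀ q ∈ 𝒜.init, [q] ∈ T)

/-- The language recognized by the automaton. -/
def language : Set (ℕ → A) :=
  {u | ∃ T : Set (List Q), 𝒜.IsRun u T ∧ 𝒜.IsInitial T ∧
    ∀ r : ℕ → Q, IsPath T r → (infOcc r ∩ 𝒜.buchi).Nonempty}

end StateAlternatingBuchi

end OmegaAutomata

/-!
The weak automaton simulates the Büchi automaton and lets the opponent, who picks the path, attach
to each state a rank below `2 * n` that never increases along a path: a state `q'` of a transition
formula becomes the conjunction of the pairs `(q', j)` with `j` at most the current rank. Once the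
opponent attaches an odd rank to a Büchi state, the automaton wins at once (the formula is
"true"), and a rank that settles at an even value is also a win for the automaton. Hence the
opponent has to settle at an odd rank, and thereby commits himself to avoiding Büchi states.

An accepting run of the Büchi automaton survives all choices of ranks
(`language_subset_language_toWeak`): a path that settled at an odd rank would meet a Büchi state.

Conversely, fix a word and consider positions (state, time). The increasing sequence
`region 0 ⊆ region 1 ⊆ ⋯` collects positions that the opponent wins with a given rank: an even
step adds the positions from which he can force, in finitely many moves, the previous region or an
unsatisfiable formula, and an odd step those from which he can avoid Büchi states unless and until
he enters the previous region. An accepting run of the weak automaton never passes through a position whose attached rank is the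
index of the first region that contains it (`exists_lt_mem_region_of_mem_run`).

The sequence has become constant by the index `2 * n - 1` (`isStable_region`). If an odd step
`2 * j + 1` adds a position, then it adds, at every later time, a position whose state is not a
Büchi state. If the steps for all `j < n` did so, then at some time all `n` states would be
outside the Büchi set, which is therefore empty; and then a single odd step already suffices. From
outside a constant region the automaton can stay outside and force a visit to a Büchi state again
and again, by always decreasing the distance to such a visit; this memoryless strategy is an
accepting run of the Büchi automaton (`exists_run_of_isStable`).

State-controlled automata are transition-controlled ones all of whose formulas are disjunctions or
conjunctions of states.
-/

namespace OmegaAutomata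

open Set

/-! ### Expressions -/

namespace Expr

variable {Q R : Type*}

theorem SatisfiedBy.mono {S S' : Set Q} {φ : Expr Q} (hφ : φ.SatisfiedBy S) (h : S ⊆ S') :
    φ.SatisfiedBy S' := by
  induction φ with
  | state q => exact h hφ
  | or φ ψ h₁ h₂ => exact hφ.imp h₁ h₂
  | and φ ψ h₁ h₂ => exact ⟨h₁ hφ.1, h₂ hφ.2⟩
  | false => exact hφ
  | true => trivial

/-- Satisfaction is continuous along increasing sequences of sets, since an expression is a finite
object. -/
theorem SatisfiedBy.exists_of_iUnion {S : ℕ → Set Q} (hS : Monotone S) {φ : Expr Q}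
    (hφ : φ.SatisfiedBy (⋃ m, S m)) : ∃ m, φ.SatisfiedBy (S m) := by
  induction φ with
  | state q => exact mem_iUnion.1 hφ
  | or φ ψ h₁ h₂ =>
    rcases hφ with h | h
    · exact (h₁ h).imp fun _ => Or.inl
    · exact (h₂ h).imp fun _ => Or.inr
  | and φ ψ h₁ h₂ =>
    obtain ⟨a, ha⟩ := h₁ hφ.1
    obtain ⟨b, hb⟩ := h₂ hφ.2
    exact ⟨max a b, ha.mono (hS (le_max_left a b)), hb.mono (hS (le_max_right a b))⟩
  | false => exact hφ.elim
  | true => exact ⟨0, trivial⟩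

/-- Substitution of expressions for states. -/
def bind (f : Q → Expr R) : Expr Q → Expr R
  | state q => f q
  | or φ ψ => or (bind f φ) (bind f ψ)
  | and φ ψ => and (bind f φ) (bind f ψ)
  | false => false
  | true => true

theorem satisfiedBy_bind {f : Q → Expr R} {S : Set R} {φ : Expr Q} :
    (φ.bind f).SatisfiedBy S ↔ φ.SatisfiedBy {q | (f q).SatisfiedBy S} := by
  induction φ with
  | state q => rfl
  | or φ ψ h₁ h₂ => exact or_congr h₁ h₂
  | and φ ψ h₁ h₂ => exact and_congr h₁ h₂
  | false => rfl
  | true => rfl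

theorem exists_of_mem_states_bind {f : Q → Expr R} {y : R} {φ : Expr Q}
    (h : y ∈ (φ.bind f).states) : ∃ q, y ∈ (f q).states := by
  induction φ with
  | state q => exact ⟨q, h⟩
  | or φ ψ h₁ h₂ => exact h.elim h₁ h₂
  | and φ ψ h₁ h₂ => exact h.elim h₁ h₂
  | false => exact h.elim
  | true => exact h.elim

/-- The conjunction of the states in a set. -/
noncomputable def allOf [Finite Q] (s : Set Q) : Expr Q :=
  s.toFinite.toFinset.toList.foldr (fun q φ => and (state q) φ) true

/-- The disjunction of the states in a set. -/
noncomputable def someOf [Finite Q] (s : Set Q) : Expr Q :=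
  s.toFinite.toFinset.toList.foldr (fun q φ => or (state q) φ) false

theorem satisfiedBy_allOf [Finite Q] {s S : Set Q} : (allOf s).SatisfiedBy S ↔ s ⊆ S := by
  have key (l : List Q) : (l.foldr (fun q φ => and (state q) φ) true).SatisfiedBy S ↔
      ∀ q ∈ l, q ∈ S := by
    induction l with
    | nil => simp [SatisfiedBy]
    | cons q l ih => simp [SatisfiedBy, ih]
  simp [allOf, key, subset_def]

theorem states_allOf [Finite Q] (s : Set Q) : (allOf s).states = s := by
  have key (l : List Q) : (l.foldr (fun q φ => and (state q) φ) true).states = {q | q ∈ l} := by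
    induction l with
    | nil => simp [states]
    | cons q l ih => ext; simp [states, ih]
  simp [allOf, key]

theorem satisfiedBy_someOf [Finite Q] {s S : Set Q} :
    (someOf s).SatisfiedBy S ↔ ∃ q ∈ s, q ∈ S := by
  have key (l : List Q) : (l.foldr (fun q φ => or (state q) φ) false).SatisfiedBy S ↔
      ∃ q ∈ l, q ∈ S := by
    induction l with
    | nil => simp [SatisfiedBy]
    | cons q l ih => simp [SatisfiedBy, ih]
  simp [someOf, key]

end Expr

/-! ### Infinite words and paths -/

section Paths

variable {Q : Type*}

theorem nonempty_infOcc_inter [Finite Q] {r : ℕ → Q} {B : Set Q}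
    (h : ∀ k, ∃ l ≥ k, r l ∈ B) : (infOcc r ∩ B).Nonempty := by
  have hinf : {l | r l ∈ B}.Infinite := by
    rw [← Nat.frequently_atTop_iff_infinite, Filter.frequently_atTop]
    exact h
  by_contra hne
  refine hinf ((B.toFinite.biUnion (t := fun q => {i | r i = q}) fun q hq => ?_).subset ?_)
  · by_contra hq'
    exact hne ⟨q, hq', hq⟩
  · intro l hl
    simpa using hl

theorem map_range_prefix (r : ℕ → Q) {k l : ℕ} (h : k ≤ l) :
    (List.range k).map r <+: (List.range l).map r := by
  obtain ⟨d, rfl⟩ := Nat.exists_eq_add_of_le h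
  rw [List.range_add, List.map_append]
  exact List.prefix_append _ _

theorem map_range_add_two (r : ℕ → Q) (k : ℕ) :
    (List.range (k + 2)).map r = (List.range k).map r ++ [r k, r (k + 1)] := by
  simp [List.range_succ]

/-- A property of finite words that can be preserved when appending a suitable letter yields an
infinite word whose long prefixes have the property. -/
theorem exists_forall_map_range {P : List Q → Prop} {w : List Q} (hw : P w)
    (hP : ∀ v, P v → ∃ x, P (v ++ [x])) :
    ∃ r : ℕ → Q, ∀ k ≥ w.length, P ((List.range k).map r) := by
  choose f hf using hP
  let s : ℕ → {v // P v} := fun m =>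
    Nat.rec ⟨w, hw⟩ (fun _ v => ⟨v.1 ++ [f v.1 v.2], hf v.1 v.2⟩) m
  let r : ℕ → Q := fun k =>
    if h : k < w.length then w[k] else f (s (k - w.length)).1 (s (k - w.length)).2
  have key (m : ℕ) : (List.range (w.length + m)).map r = (s m).1 := by
    induction m with
    | zero =>
      refine List.ext_getElem (by simp [s]) fun i h₁ h₂ => ?_
      have hi : i < w.length := by simpa using h₁
      simp [r, s, hi]
    | succ m ih =>
      rw [← Nat.add_assoc, List.range_succ, List.map_append, ih]
      simp [r, s]
  refine ⟨r, fun k hk => ?_⟩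
  obtain ⟨m, rfl⟩ := Nat.exists_eq_add_of_le hk
  rw [key]
  exact (s m).2

end Paths

/-! ### The weak automaton -/

namespace AlternatingBuchi

variable {A Q : Type*} (𝒜 : AlternatingBuchi A Q)

/-- The state `x` of the weak automaton is a Büchi state with an odd rank. -/
def Blocked {m : ℕ} (x : Q × Fin m) : Prop := x.1 ∈ 𝒜.buchi ∧ Odd (x.2 : ℕ)

open Classical in
/-- The ranked version of `𝒜`, without a recurrence condition. -/
noncomputable def ranked [Finite Q] (m : ℕ) : Alternating A (Q × Fin m) where
  init := 𝒜.init.bind fun q => .allOf {y | y.1 = q}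
  δ x a := if 𝒜.Blocked x then .true else
    (𝒜.δ x.1 a).bind fun q => .allOf {y | y.1 = q ∧ y.2 ≤ x.2}

theorem le_of_edge_ranked [Finite Q] {m : ℕ} {x y : Q × Fin m} (h : (𝒜.ranked m).Edge x y) :
    y.2 ≤ x.2 := by
  obtain ⟨a, ha⟩ := h
  simp only [ranked] at ha
  split_ifs at ha
  · exact ha.elim
  · obtain ⟨q, hq⟩ := Expr.exists_of_mem_states_bind ha
    rw [Expr.states_allOf] at hq
    exact hq.2

theorem le_of_reachable_ranked [Finite Q] {m : ℕ} {x y : Q × Fin m}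
    (h : Relation.ReflTransGen (𝒜.ranked m).Edge x y) : y.2 ≤ x.2 := by
  induction h with
  | refl => exact le_rfl
  | tail _ h ih => exact (𝒜.le_of_edge_ranked h).trans ih

/-- The weak automaton with `m` ranks: the weak states are those of even rank. Ranks are constant
on strongly connected components. -/
noncomputable def toWeak [Finite Q] (m : ℕ) : AlternatingWeak A (Q × Fin m) where
  toAlternating := 𝒜.ranked m
  weak := {x | Even (x.2 : ℕ)}
  weak_eq_sUnion := by
    refine ⟨(𝒜.ranked m).scc '' {x | Even (x.2 : ℕ)}, image_subset_range _ _, ?_⟩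
    ext y
    simp only [sUnion_image, mem_iUnion, mem_ofPred_eq, exists_prop]
    constructor
    · exact fun hy => ⟨y, hy, .refl, .refl⟩
    · rintro ⟨x, hx, hxy, hyx⟩
      rwa [(𝒜.le_of_reachable_ranked hxy).antisymm (𝒜.le_of_reachable_ranked hyx)]

theorem satisfiedBy_ranked_δ [Finite Q] {m : ℕ} {x : Q × Fin m} {a : A} {S : Set (Q × Fin m)}
    (hx : ¬ 𝒜.Blocked x) : ((𝒜.ranked m).δ x a).SatisfiedBy S ↔
      (𝒜.δ x.1 a).SatisfiedBy {q | ∀ j ≤ x.2, (q, j) ∈ S} := by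
  simp only [ranked, if_neg hx, Expr.satisfiedBy_bind, Expr.satisfiedBy_allOf]
  refine iff_of_eq (congrArg (Expr.SatisfiedBy · _) (Set.ext fun q => ?_))
  exact ⟨fun h j hj => h ⟨rfl, hj⟩, by rintro h ⟨_, j⟩ ⟨rfl, hj⟩; exact h j hj⟩

theorem satisfiedBy_ranked_init [Finite Q] {m : ℕ} {S : Set (Q × Fin m)} :
    (𝒜.ranked m).init.SatisfiedBy S ↔ 𝒜.init.SatisfiedBy {q | ∀ j, (q, j) ∈ S} := by
  simp only [ranked, Expr.satisfiedBy_bind, Expr.satisfiedBy_allOf]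
  refine iff_of_eq (congrArg (Expr.SatisfiedBy · _) (Set.ext fun q => ?_))
  exact ⟨fun h j => h rfl, by rintro h ⟨_, j⟩ rfl; exact h j⟩

/-! ### From Büchi runs to runs of the weak automaton -/

/-- `y` may follow `x` in a run of the weak automaton: ranks do not increase, and runs end at
blocked states. -/
def Step {m : ℕ} (x y : Q × Fin m) : Prop := y.2 ≤ x.2 ∧ ¬ 𝒜.Blocked x

theorem language_subset_language_toWeak [Finite Q] (m : ℕ) :
    𝒜.language ⊆ (𝒜.toWeak m).language := by
  rintro u ⟨T, ⟨hT, hrun⟩, hinit, hacc⟩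
  refine ⟨{w | w.map Prod.fst ∈ T ∧ w.IsChain 𝒜.Step}, ⟨?_, ?_⟩, ?_, ?_⟩
  · exact fun v w hvw hw => ⟨hT _ _ (hvw.map _) hw.1, hw.2.prefix hvw⟩
  · intro v x hx
    by_cases hb : 𝒜.Blocked x
    · have : (𝒜.toWeak m).δ x (u v.length) = .true := if_pos hb
      rw [this]
      trivial
    · refine (𝒜.satisfiedBy_ranked_δ hb).2 ?_
      have hx₁ : v.map Prod.fst ++ [x.1] ∈ T := by simpa using hx.1
      have h := hrun _ _ hx₁
      rw [List.length_map] at h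
      refine h.mono fun q hq j hj => ⟨by simpa using hq, ?_⟩
      have : v ++ [x, (q, j)] = (v ++ [x]) ++ [(q, j)] := by simp
      rw [this, List.isChain_append]
      refine ⟨hx.2, by simp, fun y hy z hz => ?_⟩
      obtain rfl : y = x := by simpa using hy.symm
      obtain rfl : z = (q, j) := by simpa using hz.symm
      exact ⟨hj, hb⟩
  · refine 𝒜.satisfiedBy_ranked_init.2 (Expr.SatisfiedBy.mono hinit fun q hq j => ?_)
    exact ⟨hq, by simp⟩
  · intro r hr
    have hstep (k : ℕ) : 𝒜.Step (r k) (r (k + 1)) := by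
      have h := (hr (k + 2)).2
      rw [map_range_add_two, List.isChain_append] at h
      simpa using h.2.1
    have hanti : Antitone fun k => (r k).2 := antitone_nat_of_succ_le fun k => (hstep k).1
    have hpath : IsPath T fun k => (r k).1 := fun k => by
      simpa [Function.comp_def] using (hr k).1
    obtain ⟨b, hb, hbB⟩ := hacc _ hpath
    intro x hx
    by_contra hodd
    -- The odd rank of `x` occurs infinitely often, so it is the limit of the ranks, and a later
    -- occurrence of `b` is blocked.
    obtain ⟨k, hk⟩ := hx.nonempty
    obtain ⟨l, hl, hkl⟩ := hb.exists_gt k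
    obtain ⟨k', hk', hlk'⟩ := hx.exists_gt l
    have h₁ : (r l).2 ≤ x.2 := hk ▸ hanti hkl.le
    have h₂ : x.2 ≤ (r l).2 := hk' ▸ hanti hlk'.le
    refine (hstep l).2 ⟨?_, ?_⟩
    · rw [show (r l).1 = b from hl]
      exact hbB
    · rw [h₁.antisymm h₂]
      exact Nat.not_even_iff_odd.1 hodd

/-! ### The regions of the opponent -/

variable (u : ℕ → A)

/-- The positions (state, time) from which the automaton can force the next position to be
in `X`. This includes positions where the play can end in favour of the automaton, because the
transition formula is satisfied by the empty set of states. -/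
def pre (X : Set (Q × ℕ)) : Set (Q × ℕ) :=
  {p | (𝒜.δ p.1 (u p.2)).SatisfiedBy {q | (q, p.2 + 1) ∈ X}}

/-- The positions from which the opponent can force the next position to be in `X`,
including those where the automaton loses at once because the transition formula is
unsatisfiable. -/
def opp (X : Set (Q × ℕ)) : Set (Q × ℕ) := (𝒜.pre u Xᶜ)ᶜ

variable {u}

theorem mem_pre {X : Set (Q × ℕ)} {p : Q × ℕ} :
    p ∈ 𝒜.pre u X ↔ (𝒜.δ p.1 (u p.2)).SatisfiedBy {q | (q, p.2 + 1) ∈ X} := Iff.rfl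

theorem pre_mono : Monotone (𝒜.pre u) := fun _ _ h _ hp =>
  (𝒜.mem_pre.1 hp).mono fun _ hq => h hq

theorem opp_mono : Monotone (𝒜.opp u) := fun _ _ h =>
  compl_subset_compl.2 (𝒜.pre_mono (compl_subset_compl.2 h))

/-- If both players can force a successor in their respective sets, then the sets have a common
successor. -/
theorem exists_of_satisfiedBy_of_mem_opp {X : Set (Q × ℕ)} {S : Set Q} {q : Q} {k : ℕ}
    (hS : (𝒜.δ q (u k)).SatisfiedBy S) (hX : (q, k) ∈ 𝒜.opp u X) :
    ∃ q' ∈ S, (q', k + 1) ∈ X := by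
  by_contra! h
  exact hX (hS.mono h)

variable (u)

/-- The positions from which the opponent can force, in finitely many moves, a visit to `R` or
an unsatisfiable transition formula. -/
def attract (R : Set (Q × ℕ)) : Set (Q × ℕ) :=
  OrderHom.lfp ⟨fun X => R ∪ 𝒜.opp u X, fun _ _ h => union_subset_union_right _ (𝒜.opp_mono h)⟩

/-- The positions from which the opponent can avoid Büchi states unless and until he
reaches `R`. -/
def avoid (R : Set (Q × ℕ)) : Set (Q × ℕ) :=
  OrderHom.gfp ⟨fun X => R ∪ ({p | p.1 ∉ 𝒜.buchi} ∩ 𝒜.opp u X),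
    fun _ _ h => union_subset_union_right _ (inter_subset_inter_right _ (𝒜.opp_mono h))⟩

/-- The positions that the opponent wins with ranks up to the given one. -/
def region : ℕ → Set (Q × ℕ)
  | 0 => 𝒜.attract u ∅
  | i + 1 => if Even i then 𝒜.avoid u (region i) else 𝒜.attract u (region i)

variable {u}

theorem attract_eq (R : Set (Q × ℕ)) : 𝒜.attract u R = R ∪ 𝒜.opp u (𝒜.attract u R) :=
  (OrderHom.map_lfp _).symm

theorem avoid_eq (R : Set (Q × ℕ)) :
    𝒜.avoid u R = R ∪ ({p | p.1 ∉ 𝒜.buchi} ∩ 𝒜.opp u (𝒜.avoid u R)) :=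
  (OrderHom.map_gfp _).symm

theorem attract_subset {R X : Set (Q × ℕ)} (hR : R ⊆ X) (hX : 𝒜.opp u X ⊆ X) :
    𝒜.attract u R ⊆ X :=
  OrderHom.lfp_le _ (union_subset hR hX)

theorem subset_avoid {R X : Set (Q × ℕ)}
    (hX : X ⊆ R ∪ ({p | p.1 ∉ 𝒜.buchi} ∩ 𝒜.opp u X)) : X ⊆ 𝒜.avoid u R :=
  OrderHom.le_gfp _ hX

theorem subset_attract (R : Set (Q × ℕ)) : R ⊆ 𝒜.attract u R := by
  rw [attract_eq]; exact subset_union_left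

theorem opp_attract_subset (R : Set (Q × ℕ)) : 𝒜.opp u (𝒜.attract u R) ⊆ 𝒜.attract u R := by
  conv_rhs => rw [attract_eq]
  exact subset_union_right

theorem self_subset_avoid (R : Set (Q × ℕ)) : R ⊆ 𝒜.avoid u R := by
  rw [avoid_eq]; exact subset_union_left

theorem region_succ_of_even {i : ℕ} (h : Even i) :
    𝒜.region u (i + 1) = 𝒜.avoid u (𝒜.region u i) := if_pos h

theorem region_succ_of_odd {i : ℕ} (h : Odd i) :
    𝒜.region u (i + 1) = 𝒜.attract u (𝒜.region u i) := if_neg (Nat.not_even_iff_odd.2 h)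

theorem region_mono : Monotone (𝒜.region u) := by
  refine monotone_nat_of_le_succ fun i => ?_
  rcases i.even_or_odd with h | h
  · rw [𝒜.region_succ_of_even h]; exact 𝒜.self_subset_avoid _
  · rw [𝒜.region_succ_of_odd h]; exact 𝒜.subset_attract _

/-- A region of even index absorbs the opponent's attraction. -/
theorem opp_region_subset {i : ℕ} (h : Even i) :
    𝒜.opp u (𝒜.region u i) ⊆ 𝒜.region u i := by
  cases i with
  | zero => exact 𝒜.opp_attract_subset _
  | succ i =>
    rw [𝒜.region_succ_of_odd (by grind)]
    exact 𝒜.opp_attract_subset _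

theorem subset_opp_attract {R : Set (Q × ℕ)} (h : R ⊆ 𝒜.opp u R) :
    𝒜.attract u R ⊆ 𝒜.opp u (𝒜.attract u R) := by
  conv_lhs => rw [attract_eq]
  exact union_subset (h.trans (𝒜.opp_mono (𝒜.subset_attract R))) subset_rfl

/-- In each region the opponent can stay for ever. -/
theorem region_subset_opp (i : ℕ) : 𝒜.region u i ⊆ 𝒜.opp u (𝒜.region u i) := by
  induction i with
  | zero => exact 𝒜.subset_opp_attract (empty_subset _)
  | succ i ih =>
    rcases i.even_or_odd with h | h
    · rw [𝒜.region_succ_of_even h]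
      conv_lhs => rw [avoid_eq]
      exact union_subset (ih.trans (𝒜.opp_mono (𝒜.self_subset_avoid _))) inter_subset_right
    · rw [𝒜.region_succ_of_odd h]
      exact 𝒜.subset_opp_attract ih

theorem not_mem_buchi_of_mem_region {i : ℕ} (hi : Odd i) {p : Q × ℕ} (hp : p ∈ 𝒜.region u i)
    (hlt : ∀ j < i, p ∉ 𝒜.region u j) : p.1 ∉ 𝒜.buchi := by
  obtain ⟨i, rfl⟩ := Nat.exists_eq_succ_of_ne_zero hi.pos.ne'
  rw [Nat.succ_eq_add_one, 𝒜.region_succ_of_even (by grind), avoid_eq] at hp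
  exact (hp.resolve_left (hlt i i.lt_succ_self)).1

/-! ### Runs of the weak automaton avoid the opponent's regions -/

/-- The opponent can continue inside `X` and simultaneously attach the rank of his choice. -/
theorem exists_mem_run_of_mem_opp [Finite Q] {m : ℕ} {T : Set (List (Q × Fin m))}
    (hT : (𝒜.toWeak m).IsRun u T) {v : List (Q × Fin m)} {q : Q} {i : Fin m}
    (hv : v ++ [(q, i)] ∈ T) (hb : ¬ 𝒜.Blocked (q, i)) {X : Set (Q × ℕ)}
    (hX : (q, v.length) ∈ 𝒜.opp u X) :
    ∃ q', (q', v.length + 1) ∈ X ∧ ∀ j ≤ i, v ++ [(q, i), (q', j)] ∈ T := by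
  obtain ⟨q', h, hq'⟩ := 𝒜.exists_of_satisfiedBy_of_mem_opp
    ((𝒜.satisfiedBy_ranked_δ hb).1 (hT.2 v (q, i) hv)) hX
  exact ⟨q', hq', h⟩

/-- An accepting run of the weak automaton does not contain a position together with the index of
the first region to which the position belongs. -/
theorem exists_lt_mem_region_of_mem_run [Finite Q] {m : ℕ} {T : Set (List (Q × Fin m))}
    (hT : (𝒜.toWeak m).IsRun u T)
    (hacc : ∀ r : ℕ → Q × Fin m, IsPath T r → infOcc r ⊆ (𝒜.toWeak m).weak)
    (i : ℕ) (hi : i < m) (v : List (Q × Fin m)) (q : Q) (hv : v ++ [(q, ⟨i, hi⟩)] ∈ T)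
    (hq : (q, v.length) ∈ 𝒜.region u i) : ∃ j < i, (q, v.length) ∈ 𝒜.region u j := by
  induction i using Nat.strong_induction_on generalizing v q with
  | _ i ih =>
  -- The opponent moves on to a state that enters the regions no earlier than at index `i`,
  -- because by induction he would win with a smaller rank.
  have hstep (v : List (Q × Fin m)) (q : Q) (X : Set (Q × ℕ)) (hv : v ++ [(q, ⟨i, hi⟩)] ∈ T)
      (hb : ¬ 𝒜.Blocked (q, (⟨i, hi⟩ : Fin m))) (hX : (q, v.length) ∈ 𝒜.opp u X) :
      ∃ q', (q', v.length + 1) ∈ X ∧ v ++ [(q, ⟨i, hi⟩), (q', ⟨i, hi⟩)] ∈ T ∧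
        ∀ j < i, (q', v.length + 1) ∉ 𝒜.region u j := by
    obtain ⟨q', hq'X, hq'⟩ := 𝒜.exists_mem_run_of_mem_opp hT hv hb hX
    refine ⟨q', hq'X, hq' _ le_rfl, fun j => ?_⟩
    induction j using Nat.strong_induction_on with
    | _ j ihj =>
      intro hj hmem
      obtain ⟨l, hl, hl'⟩ := ih j hj (hj.trans hi) (v ++ [(q, ⟨i, hi⟩)]) q'
        (by simpa using hq' ⟨j, hj.trans hi⟩ hj.le) (by simpa using hmem)
      exact ihj l hl (hl.trans hj) (by simpa using hl')
  by_contra! hlt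
  rcases i.even_or_odd with he | ho
  · -- While the even rank `i` is kept, the opponent reaches an earlier region or wins outright within
    -- finitely many moves: induction on the least fixed point.
    have hX : 𝒜.region u i ⊆ {p | (∃ j < i, p ∈ 𝒜.region u j) ∨
        ∀ v : List (Q × Fin m), v.length = p.2 → v ++ [(p.1, ⟨i, hi⟩)] ∉ T} := by
      have hopp : 𝒜.opp u {p | (∃ j < i, p ∈ 𝒜.region u j) ∨
          ∀ v : List (Q × Fin m), v.length = p.2 → v ++ [(p.1, ⟨i, hi⟩)] ∉ T} ⊆
          {p | (∃ j < i, p ∈ 𝒜.region u j) ∨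
          ∀ v : List (Q × Fin m), v.length = p.2 → v ++ [(p.1, ⟨i, hi⟩)] ∉ T} := by
        rintro ⟨q, k⟩ hq
        refine Or.inr fun v hvk hv => ?_
        obtain rfl : v.length = k := hvk
        obtain ⟨q', hq', hT', hlt'⟩ := hstep v q _ hv
          (fun h => (Nat.not_odd_iff_even.2 he) h.2) hq
        rcases hq' with ⟨j, hj, hj'⟩ | h
        · exact hlt' j hj hj'
        · exact h (v ++ [(q, ⟨i, hi⟩)]) (by simp) (by simpa using hT')
      cases i with
      | zero => exact 𝒜.attract_subset (empty_subset _) hopp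
      | succ i =>
        conv_lhs => rw [𝒜.region_succ_of_odd (by grind)]
        exact 𝒜.attract_subset (fun p hp => Or.inl ⟨i, i.lt_succ_self, hp⟩) hopp
    rcases hX hq with ⟨j, hj, hj'⟩ | h
    · exact hlt j hj hj'
    · exact h v rfl hv
  · -- The opponent keeps the rank `i` for ever.
    let P : List (Q × Fin m) → Prop := fun w => w ∈ T ∧ ∃ v q, w = v ++ [(q, ⟨i, hi⟩)] ∧
      (q, v.length) ∈ 𝒜.region u i ∧ ∀ j < i, (q, v.length) ∉ 𝒜.region u j
    obtain ⟨r, hr⟩ := exists_forall_map_range (P := P) ⟨hv, v, q, rfl, hq, hlt⟩ (by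
      rintro _ ⟨hw, v, q, rfl, hq, hlt⟩
      obtain ⟨q', hq', hT', hlt'⟩ := hstep v q _ hw
        (fun h => 𝒜.not_mem_buchi_of_mem_region ho hq hlt h.1) (𝒜.region_subset_opp i hq)
      exact ⟨(q', ⟨i, hi⟩), by simpa using hT', v ++ [(q, ⟨i, hi⟩)], q', rfl,
        by simpa using hq', by simpa using hlt'⟩)
    have hpath : IsPath T r := fun k =>
      hT.1 _ _ (map_range_prefix r (le_max_left k _)) (hr _ (le_max_right k _)).1
    obtain ⟨x, hx, hxi⟩ := nonempty_infOcc_inter (r := r) (B := {x | (x.2 : ℕ) = i}) fun k => by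
      refine ⟨max k (v ++ [(q, (⟨i, hi⟩ : Fin m))]).length, le_max_left _ _, ?_⟩
      obtain ⟨-, v', q', h, -⟩ := hr (max k (v ++ [(q, (⟨i, hi⟩ : Fin m))]).length + 1)
        ((le_max_right _ _).trans (Nat.le_succ _))
      rw [List.range_succ, List.map_append] at h
      have := (List.append_inj' h rfl).2
      simp only [List.map_cons, List.map_nil, List.cons.injEq, and_true] at this
      rw [mem_ofPred_eq, this]
    have hxe : Even (x.2 : ℕ) := hacc r hpath hx
    rw [show (x.2 : ℕ) = i from hxi] at hxe
    exact Nat.not_even_iff_odd.2 ho hxe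

/-! ### The regions become constant -/

variable (u)

/-- `R` is a fixed point of both operations that produce the regions. -/
structure IsStable (R : Set (Q × ℕ)) : Prop where
  opp_subset : 𝒜.opp u R ⊆ R
  avoid_subset : 𝒜.avoid u R ⊆ R

variable {u}

theorem IsStable.region_subset {𝒜 : AlternatingBuchi A Q} {R : Set (Q × ℕ)}
    (h : 𝒜.IsStable u R) (i : ℕ) : 𝒜.region u i ⊆ R := by
  induction i with
  | zero => exact 𝒜.attract_subset (empty_subset _) h.opp_subset
  | succ i ih =>
    rcases i.even_or_odd with hi | hi
    · rw [𝒜.region_succ_of_even hi]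
      refine Subset.trans (𝒜.subset_avoid ?_) h.avoid_subset
      conv_lhs => rw [avoid_eq]
      exact union_subset_union_left _ ih
    · rw [𝒜.region_succ_of_odd hi]
      exact 𝒜.attract_subset ih h.opp_subset

/-- A position added by an odd step is followed by such positions at all later times: the opponent
can stay in the new region, the automaton can stay outside the old one. -/
theorem exists_mem_region_of_le {i : ℕ} (hi : Even i) {q : Q} {k : ℕ}
    (h : (q, k) ∈ 𝒜.region u (i + 1)) (h' : (q, k) ∉ 𝒜.region u i) {l : ℕ} (hl : k ≤ l) :
    ∃ q', (q', l) ∈ 𝒜.region u (i + 1) ∧ (q', l) ∉ 𝒜.region u i := by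
  induction l, hl using Nat.le_induction with
  | base => exact ⟨q, h, h'⟩
  | succ l _ ih =>
    obtain ⟨q₁, h₁, h₁'⟩ := ih
    have hpre : (q₁, l) ∈ 𝒜.pre u (𝒜.region u i)ᶜ := by
      by_contra hn
      exact h₁' (𝒜.opp_region_subset hi hn)
    obtain ⟨q₂, h₂', h₂⟩ :=
      𝒜.exists_of_satisfiedBy_of_mem_opp hpre (𝒜.region_subset_opp _ h₁)
    exact ⟨q₂, h₂, h₂'⟩

theorem exists_region_succ_subset [Finite Q] (hB : 𝒜.buchi.Nonempty) :
    ∃ j < Nat.card Q, 𝒜.region u (2 * j + 1) ⊆ 𝒜.region u (2 * j) := by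
  by_contra! h
  have h' (j : Fin (Nat.card Q)) :
      ∃ p, p ∈ 𝒜.region u (2 * j + 1) ∧ p ∉ 𝒜.region u (2 * j) := not_subset.1 (h j j.2)
  choose p hp hp' using h'
  obtain ⟨K, hK⟩ := (finite_range fun j => (p j).2).bddAbove
  have hex (j : Fin (Nat.card Q)) :
      ∃ q, (q, K) ∈ 𝒜.region u (2 * j + 1) ∧ (q, K) ∉ 𝒜.region u (2 * j) :=
    𝒜.exists_mem_region_of_le (by simp) (hp j) (hp' j) (hK ⟨j, rfl⟩)
  choose f hf hf' using hex
  have hinj : f.Injective := by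
    refine .of_lt_imp_ne fun i j hij heq => hf' j ?_
    rw [← heq]
    refine 𝒜.region_mono ?_ (hf i)
    have : (i : ℕ) < j := hij
    lia
  have hsurj : f.Surjective :=
    ((Nat.bijective_iff_injective_and_card f).2 ⟨hinj, by simp⟩).2
  obtain ⟨b, hb⟩ := hB
  obtain ⟨j, rfl⟩ := hsurj b
  refine 𝒜.not_mem_buchi_of_mem_region (i := 2 * j + 1) (by simp) (hf j) (fun i hi hmem => ?_) hb
  exact hf' j (𝒜.region_mono (by lia) hmem)

theorem isStable_region_of_buchi_eq_empty (hB : 𝒜.buchi = ∅) {i : ℕ} (hi : Odd i) :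
    𝒜.IsStable u (𝒜.region u i) := by
  have hsub := 𝒜.region_subset_opp (u := u) i
  obtain ⟨i, rfl⟩ := Nat.exists_eq_succ_of_ne_zero hi.pos.ne'
  -- Without Büchi states, the opponent wins once he can move for ever.
  have key {X : Set (Q × ℕ)} (hX : X ⊆ 𝒜.opp u X) : X ⊆ 𝒜.region u (i + 1) := by
    rw [𝒜.region_succ_of_even (by grind)]
    exact 𝒜.subset_avoid fun p hp => Or.inr ⟨by simp [hB], hX hp⟩
  refine ⟨key (𝒜.opp_mono hsub), key ?_⟩
  conv_lhs => rw [avoid_eq]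
  exact union_subset (hsub.trans (𝒜.opp_mono (𝒜.self_subset_avoid _))) inter_subset_right

theorem isStable_region [Finite Q] : 𝒜.IsStable u (𝒜.region u (2 * Nat.card Q - 1)) := by
  rcases isEmpty_or_nonempty Q with hQ | hQ
  · exact ⟨fun p => isEmptyElim p.1, fun p => isEmptyElim p.1⟩
  have hcard : 0 < Nat.card Q := Nat.card_pos
  rcases 𝒜.buchi.eq_empty_or_nonempty with hB | hB
  · exact 𝒜.isStable_region_of_buchi_eq_empty hB ⟨Nat.card Q - 1, by lia⟩
  · obtain ⟨j, hj, hsub⟩ := 𝒜.exists_region_succ_subset (u := u) hB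
    rw [𝒜.region_succ_of_even (by simp)] at hsub
    have hst : 𝒜.IsStable u (𝒜.region u (2 * j)) := ⟨𝒜.opp_region_subset (by simp), hsub⟩
    rwa [(hst.region_subset (2 * Nat.card Q - 1)).antisymm (𝒜.region_mono (by lia))]

/-! ### Winning the Büchi condition outside a stable region -/

/-- The positions from which the automaton can force, in fewer than `m` moves and staying inside
`C`, a visit to a Büchi state or the end of the play in its favour. -/
def reach (u : ℕ → A) (C : Set (Q × ℕ)) : ℕ → Set (Q × ℕ)
  | 0 => ∅
  | m + 1 => C ∩ ({p | p.1 ∈ 𝒜.buchi} ∪ 𝒜.pre u (reach u C m))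

theorem reach_mono (C : Set (Q × ℕ)) : Monotone (𝒜.reach u C) := by
  refine monotone_nat_of_le_succ fun m => ?_
  induction m with
  | zero => exact empty_subset _
  | succ m ih =>
    exact inter_subset_inter_right _ (union_subset_union_right _ (𝒜.pre_mono ih))

theorem reach_subset (C : Set (Q × ℕ)) (m : ℕ) : 𝒜.reach u C m ⊆ C := by
  cases m with
  | zero => exact empty_subset _
  | succ m => exact inter_subset_left

/-- Outside a stable region, the automaton can force a visit to a Büchi state in a bounded number of
moves. The bound is a natural number because satisfaction of expressions is continuous. -/
theorem IsStable.exists_mem_reach {𝒜 : AlternatingBuchi A Q} {R : Set (Q × ℕ)}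
    (h : 𝒜.IsStable u R) {p : Q × ℕ} (hp : p ∉ R) : ∃ m, p ∈ 𝒜.reach u Rᶜ m := by
  by_contra! hn
  refine hp (h.avoid_subset (𝒜.subset_avoid (X := (⋃ m, 𝒜.reach u Rᶜ m)ᶜ) ?_ (by simpa using hn)))
  intro p hp
  by_cases hpR : p ∈ R
  · exact Or.inl hpR
  have hp' : ∀ m, p ∉ 𝒜.reach u Rᶜ m := by simpa using hp
  refine Or.inr ⟨fun hb => hp' 1 ⟨hpR, Or.inl hb⟩, fun hpre => ?_⟩
  rw [compl_compl] at hpre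
  have hpre' : (𝒜.δ p.1 (u p.2)).SatisfiedBy
      (⋃ m, {q | (q, p.2 + 1) ∈ 𝒜.reach u Rᶜ m}) :=
    hpre.mono fun q hq => by simpa using hq
  obtain ⟨m, hm⟩ := Expr.SatisfiedBy.exists_of_iUnion
    (S := fun m => {q | (q, p.2 + 1) ∈ 𝒜.reach u Rᶜ m})
    (fun a b hab q hq => 𝒜.reach_mono _ hab hq) hpre'
  exact hp' (m + 1) ⟨hpR, Or.inr hm⟩

/-- If the initial condition can be satisfied outside a stable region, then the automaton accepts:
it stays outside the region and, at positions without a Büchi state, decreases the distance to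
the next forced visit to a Büchi state. -/
theorem exists_run_of_isStable [Finite Q] {R : Set (Q × ℕ)} (h : 𝒜.IsStable u R)
    (hinit : 𝒜.init.SatisfiedBy {q | (q, 0) ∉ R}) : u ∈ 𝒜.language := by
  classical
  have hreach (p : Q × ℕ) : ∃ d, p ∉ R → p ∈ 𝒜.reach u Rᶜ d := by
    by_cases hp : p ∈ R
    · exact ⟨0, fun hn => (hn hp).elim⟩
    · exact (h.exists_mem_reach hp).imp fun _ hd _ => hd
  let d : Q × ℕ → ℕ := fun p => Nat.find (hreach p)
  have hd (p : Q × ℕ) (hp : p ∉ R) : p ∈ 𝒜.reach u Rᶜ (d p) := Nat.find_spec (hreach p) hp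
  have hd_le (p : Q × ℕ) (m : ℕ) (hp : p ∈ 𝒜.reach u Rᶜ m) : d p ≤ m :=
    Nat.find_min' (hreach p) fun _ => hp
  -- The words that follow the strategy; `d` measures the distance to the next forced visit.
  let good : List Q → Prop := fun w => ∀ (v : List Q) (q : Q), v ++ [q] <+: w →
    (q, v.length) ∉ R ∧ ∀ q', v ++ [q, q'] <+: w → q ∉ 𝒜.buchi →
      d (q', v.length + 1) < d (q, v.length)
  refine ⟨{w | good w}, ⟨fun v w hvw hw x q hx =>
    ⟨(hw x q (hx.trans hvw)).1, fun q' hq' => (hw x q (hx.trans hvw)).2 q' (hq'.trans hvw)⟩,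
    fun v q hv => ?_⟩, ?_, ?_⟩
  · have hq : (q, v.length) ∉ R := (hv v q List.prefix_rfl).1
    have hpre : (𝒜.δ q (u v.length)).SatisfiedBy {q' | (q', v.length + 1) ∉ R ∧
        (q ∉ 𝒜.buchi → d (q', v.length + 1) < d (q, v.length))} := by
      by_cases hb : q ∈ 𝒜.buchi
      · have : (q, v.length) ∈ 𝒜.pre u Rᶜ := by
          by_contra hn
          exact hq (h.opp_subset hn)
        exact (𝒜.mem_pre.1 this).mono fun q' hq' => ⟨hq', fun hn => (hn hb).elim⟩
      · have hdq := hd _ hq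
        generalize hm : d (q, v.length) = m at hdq
        cases m with
        | zero => exact hdq.elim
        | succ m =>
          have : (q, v.length) ∈ 𝒜.pre u (𝒜.reach u Rᶜ m) := hdq.2.resolve_left hb
          exact (𝒜.mem_pre.1 this).mono fun q' hq' =>
            ⟨𝒜.reach_subset _ _ hq', fun _ => Nat.lt_succ_of_le (hd_le _ _ hq')⟩
    refine hpre.mono fun q' hq' x y hx => ?_
    have happ : v ++ [q, q'] = (v ++ [q]) ++ [q'] := by simp
    rw [happ, List.prefix_concat_iff] at hx
    rcases hx with hx | hx
    · obtain ⟨rfl, hy⟩ := List.append_inj' hx rfl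
      obtain rfl : y = q' := by simpa using hy
      refine ⟨by simpa using hq'.1, fun z hz => ?_⟩
      have := hz.length_le
      simp at this
    · refine ⟨(hv x y hx).1, fun z hz hy => ?_⟩
      rw [happ, List.prefix_concat_iff] at hz
      rcases hz with hz | hz
      · have hz' : (x ++ [y]) ++ [z] = (v ++ [q]) ++ [q'] := by simpa using hz
        obtain ⟨h₁, h₂⟩ := List.append_inj' hz' rfl
        obtain ⟨rfl, h₃⟩ := List.append_inj' h₁ rfl
        obtain rfl : z = q' := by simpa using h₂
        obtain rfl : y = q := by simpa using h₃
        exact hq'.2 hy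
      · exact (hv x y hx).2 z hz hy
  · refine Expr.SatisfiedBy.mono hinit fun q hq v x hx => ?_
    have hlen := hx.length_le
    obtain rfl : v = [] := by
      rw [← List.length_eq_zero_iff]
      simpa using hlen
    obtain rfl : x = q := by simpa using hx
    refine ⟨hq, fun q' hq' => ?_⟩
    have := hq'.length_le
    simp at this
  · intro r hr
    have hdec (k : ℕ) (hk : r k ∉ 𝒜.buchi) : d (r (k + 1), k + 1) < d (r k, k) := by
      have hpre : (List.range k).map r ++ [r k] <+: (List.range (k + 2)).map r := by
        simp [List.range_succ]
      have := (hr (k + 2) _ _ hpre).2 (r (k + 1)) (by simp [map_range_add_two]) hk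
      simpa using this
    refine nonempty_infOcc_inter fun k => ?_
    by_contra! hn
    have hbound (m : ℕ) : d (r (k + m), k + m) + m ≤ d (r k, k) := by
      induction m with
      | zero => simp
      | succ m ih =>
        have := hdec (k + m) (hn _ (Nat.le_add_right _ _))
        rw [← Nat.add_assoc]
        lia
    have := hbound (d (r k, k) + 1)
    lia

theorem language_toWeak [Finite Q] : (𝒜.toWeak (2 * Nat.card Q)).language = 𝒜.language := by
  refine Subset.antisymm ?_ (𝒜.language_subset_language_toWeak _)
  rintro u ⟨T, hT, hinit, hacc⟩
  refine 𝒜.exists_run_of_isStable 𝒜.isStable_region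
    (Expr.SatisfiedBy.mono (𝒜.satisfiedBy_ranked_init.1 hinit) fun q hq hmem => ?_)
  have : Nonempty Q := ⟨q⟩
  have hcard : 0 < Nat.card Q := Nat.card_pos
  have key (i : ℕ) : i < 2 * Nat.card Q → (q, 0) ∉ 𝒜.region u i := by
    induction i using Nat.strong_induction_on with
    | _ i ih =>
      intro hi hmem
      obtain ⟨j, hj, hj'⟩ :=
        𝒜.exists_lt_mem_region_of_mem_run hT hacc i hi [] q (hq ⟨i, hi⟩) hmem
      exact ih j hj (hj.trans hi) hj'
  exact key _ (by lia) hmem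

end AlternatingBuchi

/-! ### State-controlled automata -/

namespace StateAlternatingBuchi

variable {A Q : Type*} (𝒜 : StateAlternatingBuchi A Q)

open Classical in
/-- The transition-controlled automaton of a state-controlled one. An empty set of initial states
is read as universal, so that the initial condition is "true". -/
noncomputable def toAlternatingBuchi [Finite Q] : AlternatingBuchi A Q where
  init := if 𝒜.init ⊆ 𝒜.existentialᶜ then .allOf 𝒜.init else .someOf 𝒜.init
  δ q a := if q ∈ 𝒜.existential then .someOf {q' | (q, a, q') ∈ 𝒜.Δ}
    else .allOf {q' | (q, a, q') ∈ 𝒜.Δ}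
  buchi := 𝒜.buchi

theorem language_toAlternatingBuchi [Finite Q] : 𝒜.toAlternatingBuchi.language = 𝒜.language := by
  have hrun (u : ℕ → A) (T : Set (List Q)) :
      𝒜.toAlternatingBuchi.IsRun u T ↔ 𝒜.IsRun u T := by
    refine and_congr_right fun _ => forall_congr' fun v => forall_congr' fun q =>
      imp_congr_right fun _ => ?_
    by_cases hq : q ∈ 𝒜.existential
    · simp [toAlternatingBuchi, hq, Expr.satisfiedBy_someOf, and_comm]
    · simp [toAlternatingBuchi, hq, Expr.satisfiedBy_allOf, subset_def]
  have hinit (T : Set (List Q)) : 𝒜.toAlternatingBuchi.IsInitial T ↔ 𝒜.IsInitial T := by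
    by_cases h : 𝒜.init ⊆ 𝒜.existentialᶜ
    · have : 𝒜.toAlternatingBuchi.init = .allOf 𝒜.init := if_pos h
      rw [Alternating.IsInitial, this, Expr.satisfiedBy_allOf]
      refine ⟨fun hT => Or.inr ⟨h, hT⟩, ?_⟩
      rintro (⟨he, q, hq, -⟩ | hT)
      · exact (h hq (he hq)).elim
      · exact hT.2
    · have : 𝒜.toAlternatingBuchi.init = .someOf 𝒜.init := if_neg h
      rw [Alternating.IsInitial, this, Expr.satisfiedBy_someOf]
      refine ⟨fun hT => Or.inl ⟨𝒜.init_subset.resolve_right h, hT⟩, ?_⟩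
      rintro (hT | hT)
      · exact hT.2
      · exact (h hT.1).elim
  ext u
  exact exists_congr fun T => and_congr (hrun u T) (and_congr_left' (hinit T))

end StateAlternatingBuchi

end OmegaAutomata

theorem mainTheorem12 {A Q : Type*} [Finite Q] (n : ℕ) (hn : Nat.card Q = n) :
    Nat.card (Q × Fin (2 * n)) = 2 * n ^ 2 ∧
    (∀ 𝒜 : OmegaAutomata.AlternatingBuchi A Q,
      ∃ 𝒲 : OmegaAutomata.AlternatingWeak A (Q × Fin (2 * n)), 𝒲.language = 𝒜.language) ∧
    (∀ 𝒜 : OmegaAutomata.StateAlternatingBuchi A Q,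
      ∃ 𝒲 : OmegaAutomata.AlternatingWeak A (Q × Fin (2 * n)), 𝒲.language = 𝒜.language) := by
  subst hn
  refine ⟨?_, fun 𝒜 => ⟨𝒜.toWeak _, 𝒜.language_toWeak⟩,
    fun 𝒜 => ⟨𝒜.toAlternatingBuchi.toWeak _, ?_⟩⟩
  · rw [Nat.card_prod, Nat.card_fin]
    ring
  · rw [𝒜.toAlternatingBuchi.language_toWeak, 𝒜.language_toAlternatingBuchi]
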